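/- Let $n\ge 2$ and $d_1,\dots,d_n\ge 1$ be integers, $\mathcal H=\mathbb C^{d_1}\otimes\dots\otimes\mathbb C^{d_n}$ and $D=d_1\cdots d_n=\dim\mathcal H$. Sums over $p|q$ run over the $2^{n-1}-1$ unordered partitions of $\{1,\dots,n\}$ into two non-empty parts $p,q$; write $d_p=\prod_{i\in p}d_i$ and $d_q=\prod_{i\in q}d_i$. For a vector $\psi\in\mathcal H$ put $$\tau_{p|q}(\psi)=2\Big(1-\operatorname{tr}\big(\operatorname{tr}_p|\psi\rangle\langle\psi|\big)^2\Big),\qquad \tau_1(\psi)=\frac1{2^{n-1}-1}\sum_{p|q}\tau_{p|q}(\psi),$$ where $\operatorname{tr}_p$ is the partial trace over the factors in $p$ (for unit vectors, $\tau_1$ is the $n$-party one-tangle). The entangling power of an operator $U$ on $\mathcal H$ is the average $$\epsilon_1(U)=\big\langle\tau_1\big(U(\psi_1\otimes\dots\otimes\psi_n)\big)\big\rangle$$ over independent unit vectors $\psi_i\in\mathbb C^{d_i}$, each distributed according to the unitarily invariant probability measure on the unit sphere of $\mathbb C^{d_i}$. Let $$B=\sum_{i_1,\dots,i_n=0}^{1}d_1^{i_1}\cdots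 d_n^{i_n},\qquad C=\sum_{p|q}(d_p+d_q).$$ (a) The function $\epsilon_1$ is integrable with respect to the normalized Haar measure of the unitary group $U(D)$ of $\mathcal H$, and its mean is $$\langle\epsilon_1\rangle_{U(D)}=2\left[1-\left(\prod_{i=1}^n\frac1{d_i+1}\right)\frac{BC}{(2^{n-1}-1)(D+1)}\right].$$ (b) If $D>1$, then $\epsilon_1$ is integrable with respect to the normalized Haar measure of the orthogonal group $O(D)$ (the $D\times D$ orthogonal matrices, real in the product basis of $\mathcal H$), and its mean is $$\langle\epsilon_1\rangle_{O(D)}=2\left[1-\left(\prod_{i=1}^n\frac1{d_i+1}\right)\frac{2^n(D+1)-2B+\frac{BD-2^n}{2^{n-1}-1}\,C}{(D-1)(D+2)}\right].$$ -/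

import Mathlib

open MeasureTheory
open scoped Matrix

namespace EntanglingPower

/-! ### Haar measure on the unitary and orthogonal groups -/

/-- The unitary group (over `ℂ`) and the orthogonal group (over `ℝ`) carry the Borel sigma-algebra
of the subspace topology inherited from the space of matrices. -/
instance instMeasurableSpaceUnitaryGroup (ι 𝕜 : Type) [Fintype ι] [DecidableEq ι] [RCLike 𝕜] :
    MeasurableSpace (Matrix.unitaryGroup ι 𝕜) := borel _

instance instBorelSpaceUnitaryGroup (ι 𝕜 : Type) [Fintype ι] [DecidableEq ι] [RCLike 𝕜] :
    BorelSpace (Matrix.unitaryGroup ι 𝕜) := ⟨rfl⟩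

instance instCompactSpaceUnitaryGroup (ι 𝕜 : Type) [Fintype ι] [DecidableEq ι] [RCLike 𝕜] :
    CompactSpace (Matrix.unitaryGroup ι 𝕜) := by
  refine (isCompact_iff_compactSpace
    (s := (Matrix.unitaryGroup ι 𝕜 : Set (Matrix ι ι 𝕜)))).mp ?_
  have hK : IsCompact (Set.univ.pi fun _ : ι => Set.univ.pi fun _ : ι =>
      Metric.closedBall (0 : 𝕜) 1) :=
    isCompact_univ_pi fun _ => isCompact_univ_pi fun _ => isCompact_closedBall _ _
  have hcl : IsClosed ((Matrix.unitaryGroup ι 𝕜 : Set (Matrix ι ι 𝕜))) := by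
    have h : (Matrix.unitaryGroup ι 𝕜 : Set (Matrix ι ι 𝕜)) = {A | A * star A = 1} := by
      ext A
      exact Matrix.mem_unitaryGroup_iff
    rw [h]
    exact isClosed_eq (by fun_prop) continuous_const
  refine IsCompact.of_isClosed_subset (s := Set.univ.pi fun _ : ι => Set.univ.pi fun _ : ι =>
      Metric.closedBall (0 : 𝕜) 1) hK hcl ?_
  intro A hA i _ j _
  rw [mem_closedBall_zero_iff]
  exact entry_norm_bound_of_unitary hA i j

/-- The normalized Haar measure on a compact group. -/
noncomputable def haarProb (G : Type) [Group G] [TopologicalSpace G] [IsTopologicalGroup G]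
    [CompactSpace G] [MeasurableSpace G] [BorelSpace G] : Measure G :=
  Measure.haarMeasure ⊤

/-! ### Fully separable pure states and their invariant measure -/

/-- Unit vectors of `ℂ^d` (pure states; all functions considered below are phase invariant). -/
abbrev PureState (d : ℕ) : Type := Metric.sphere (0 : EuclideanSpace ℂ (Fin d)) 1

/-- The unitarily invariant probability measure on pure states of `ℂ^d`: the surface measure of the
unit sphere of `ℂ^d`, divided by its total mass. -/
noncomputable def pureStateMeasure (d : ℕ) : Measure (PureState d) :=
  ((volume : Measure (EuclideanSpace ℂ (Fin d))).toSphere Set.univ)⁻¹ •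
    (volume : Measure (EuclideanSpace ℂ (Fin d))).toSphere

theorem isProbabilityMeasure_pureStateMeasure (d : ℕ) (hd : 1 ≤ d) :
    IsProbabilityMeasure (pureStateMeasure d) := by
  have : Nonempty (Fin d) := ⟨⟨0, hd⟩⟩
  have : NeZero ((volume : Measure (EuclideanSpace ℂ (Fin d))).toSphere) :=
    ⟨Measure.toSphere_ne_zero _⟩
  exact isProbabilityMeasureSMul

/-- `pureStateMeasure d` is invariant under all unitary maps of `ℂ^d`. -/
theorem pureStateMeasure_invariant (d : ℕ)
    (V : EuclideanSpace ℂ (Fin d) ≃ₗᵢ[ℂ] EuclideanSpace ℂ (Fin d)) :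
    (pureStateMeasure d).map
      (fun x : PureState d => (⟨V x.1, by have := x.2; simp at this ⊢⟩ : PureState d)) =
    pureStateMeasure d := by
  have hsph : ∀ x : PureState d, V x.1 ∈ Metric.sphere (0 : EuclideanSpace ℂ (Fin d)) 1 := by
    intro x; have := x.2; simp at this ⊢
  have hm : Measurable (fun x : PureState d => (⟨V x.1, hsph x⟩ : PureState d)) :=
    (by fun_prop : Continuous (fun x : PureState d => (⟨V x.1, hsph x⟩ : PureState d))).measurable
  let W : EuclideanSpace ℂ (Fin d) ≃ₗᵢ[ℝ] EuclideanSpace ℂ (Fin d) :=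
    { V.toLinearEquiv.restrictScalars ℝ with norm_map' := V.norm_map }
  have hW : MeasurePreserving W volume volume := W.measurePreserving
  unfold pureStateMeasure
  rw [Measure.map_smul]
  congr 1
  ext s hs
  rw [Measure.map_apply hm hs, Measure.toSphere_apply' _ (hm hs), Measure.toSphere_apply' _ hs]
  congr 1
  have hpre : ∀ t : Set (EuclideanSpace ℂ (Fin d)), volume (W ⁻¹' t) = volume t := fun t =>
    MeasurePreserving.measure_preimage_equiv (f := W.toHomeomorph.toMeasurableEquiv) hW t
  open scoped Pointwise in
  rw [← hpre (Set.Ioo (0 : ℝ) 1 • (Subtype.val '' s : Set (EuclideanSpace ℂ (Fin d))))]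
  congr 1
  ext x
  simp only [Set.mem_smul, Set.mem_image, Set.mem_preimage]
  constructor
  · rintro ⟨r, hr, _, ⟨y, hy, rfl⟩, rfl⟩
    exact ⟨r, hr, _, ⟨_, hy, rfl⟩, (map_smul W r y.1).symm⟩
  · rintro ⟨r, hr, _, ⟨y, hy, rfl⟩, h⟩
    refine ⟨r, hr, W.symm y.1, ⟨⟨W.symm y.1, ?_⟩, ?_, rfl⟩, ?_⟩
    · have := y.2; simp at this ⊢
    · have : V (W.symm y.1) = y.1 := W.apply_symm_apply y.1
      simpa [this] using hy
    · apply W.injective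
      rw [map_smul, W.apply_symm_apply]; exact h

/-- The index set of the product basis `|j_1 … j_n⟩` of `H = ℂ^{d_1} ⊗ … ⊗ ℂ^{d_n}`.
Vectors of `H` are functions `MultiIndex d → ℂ`, operators are matrices over `MultiIndex d`. -/
abbrev MultiIndex {n : ℕ} (d : Fin n → ℕ) : Type := ∀ i : Fin n, Fin (d i)

/-- The product state `ψ_1 ⊗ … ⊗ ψ_n` in the product basis. -/
noncomputable def productState {n : ℕ} (d : Fin n → ℕ) (ψ : ∀ i : Fin n, PureState (d i)) :
    MultiIndex d → ℂ :=
  fun j => ∏ i, (ψ i : EuclideanSpace ℂ (Fin (d i))) (j i)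

/-- The invariant probability measure on fully separable pure states: the local factors are
independent and uniformly distributed. -/
noncomputable def separableMeasure {n : ℕ} (d : Fin n → ℕ) :
    Measure (∀ i : Fin n, PureState (d i)) :=
  Measure.pi fun i => pureStateMeasure (d i)

/-! ### Partial trace, generalized concurrence, one-tangle -/

/-- The multi-index with components `c` on the parties in `g` and `a` on the others. -/
def glue {n : ℕ} {d : Fin n → ℕ} (g : Finset (Fin n)) (c : ∀ i : {i // i ∈ g}, Fin (d i))
    (a : ∀ i : {i // i ∉ g}, Fin (d i)) : MultiIndex d :=
  fun i => if h : i ∈ g then c ⟨i, h⟩ else a ⟨i, h⟩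

/-- The partial trace `tr_g`, tracing out the parties in `g`. -/
noncomputable def partialTrace {n : ℕ} {d : Fin n → ℕ} (g : Finset (Fin n))
    (ρ : Matrix (MultiIndex d) (MultiIndex d) ℂ) :
    Matrix (∀ i : {i // i ∉ g}, Fin (d i)) (∀ i : {i // i ∉ g}, Fin (d i)) ℂ :=
  Matrix.of fun a b => ∑ c : (∀ i : {i // i ∈ g}, Fin (d i)), ρ (glue g c a) (glue g c b)

/-- The projector `|ψ⟩⟨ψ|`. -/
noncomputable def ketBra {n : ℕ} {d : Fin n → ℕ} (ψ : MultiIndex d → ℂ) :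
    Matrix (MultiIndex d) (MultiIndex d) ℂ :=
  Matrix.vecMulVec ψ (star ψ)

/-- The generalized concurrence `τ_{g|g'}(ψ) = 2 (1 - tr (tr_g |ψ⟩⟨ψ|)^2)`, with `g'` the
complement of `g`. The trace is that of the square of a Hermitian matrix, hence real. -/
noncomputable def concurrence {n : ℕ} {d : Fin n → ℕ} (g : Finset (Fin n))
    (ψ : MultiIndex d → ℂ) : ℝ :=
  2 * (1 - (Matrix.trace (partialTrace g (ketBra ψ) ^ 2)).re)

theorem trace_partialTrace_sq {n : ℕ} {d : Fin n → ℕ} (g : Finset (Fin n)) (ψ : MultiIndex d → ℂ) :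
  Matrix.trace (partialTrace g (ketBra ψ) ^ 2) = ∑ j : MultiIndex d, ∑ k : MultiIndex d,
    ψ j * star (ψ (fun i => if i ∈ g then j i else k i)) * 
     (ψ k * star (ψ (fun i => if i ∈ g then k i else j i))) := by
  let e := (Equiv.piEquivPiSubtypeProd (· ∈ g) (fun i => Fin (d i)))
  have he : ∀ p, e.symm p = glue g p.1 p.2 := fun p => rfl
  have h1 : ∀ c a c' a', (fun i => if i ∈ g then glue (d := d) g c a i else glue g c' a' i) = glue g c a' := by
    intro c a c' a'; ext i; by_cases h : i ∈ g <;> simp [glue, h]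
  rw [← e.symm.sum_comp]
  simp_rw [← e.symm.sum_comp (fun k => ψ _ * star (ψ _) * _), he, h1]
  simp only [Fintype.sum_prod_type, sq, Matrix.trace, Matrix.mul_apply, partialTrace, Matrix.of_apply,
    Matrix.diag, ketBra, Matrix.vecMulVec_apply, Pi.star_apply, Finset.sum_mul, Finset.mul_sum]
  rw [Finset.sum_comm (s := (Finset.univ : Finset (∀ i : {i // i ∈ g}, Fin (d i))))]
  refine Finset.sum_congr rfl fun a _ => ?_
  symm
  simp_rw [fun c => Finset.sum_comm (s := (Finset.univ : Finset (∀ i : {i // i ∈ g}, Fin (d i))))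
    (t := (Finset.univ : Finset (∀ i : {i // i ∉ g}, Fin (d i))))
    (f := fun c' b => ψ (glue g c a) * star (ψ (glue g c b)) *
      (ψ (glue g c' b) * star (ψ (glue g c' a))))]
  rw [Finset.sum_comm]
  exact Finset.sum_congr rfl fun b _ => Finset.sum_comm

/-- The generalized concurrence of a bipartition does not depend on which part is traced out. -/
theorem concurrence_compl {n : ℕ} {d : Fin n → ℕ} (g : Finset (Fin n))
    (ψ : MultiIndex d → ℂ) : concurrence gᶜ ψ = concurrence g ψ := by
  unfold concurrence
  rw [trace_partialTrace_sq, trace_partialTrace_sq]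
  have h : ∀ j k : MultiIndex d,
      ψ j * star (ψ (fun i => if i ∈ gᶜ then j i else k i)) *
        (ψ k * star (ψ (fun i => if i ∈ gᶜ then k i else j i))) =
      ψ j * star (ψ (fun i => if i ∈ g then j i else k i)) *
        (ψ k * star (ψ (fun i => if i ∈ g then k i else j i))) := by
    intro j k
    simp only [Finset.mem_compl, ite_not]
    ring
  simp only [h]

theorem continuous_concurrence {n : ℕ} {d : Fin n → ℕ} (g : Finset (Fin n)) :
    Continuous (fun ψ : MultiIndex d → ℂ => concurrence g ψ) := by
  unfold concurrence
  simp only [trace_partialTrace_sq]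
  fun_prop

/-- The non-trivial unordered bipartitions `p|q` of the `n` parties, each given by its part `p`
that contains the first party; the other part is the complement `q = pᶜ`. The choice of the part
is immaterial by `concurrence_compl`. -/
def bipartitions (n : ℕ) : Finset (Finset (Fin n)) :=
  Finset.univ.filter fun p => (∀ i : Fin n, i.val = 0 → i ∈ p) ∧ p ≠ Finset.univ

/-- The one-tangle of `n` parties: the average of the generalized concurrence over the
`2^{n-1} - 1` non-trivial unordered bipartitions. -/
noncomputable def oneTangle {n : ℕ} {d : Fin n → ℕ} (ψ : MultiIndex d → ℂ) : ℝ :=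
  1 / ((2 : ℝ) ^ (n - 1) - 1) * ∑ p ∈ bipartitions n, concurrence p ψ

/-! ### Entangling power -/

/-- The entangling power of `U` with respect to a measure of entanglement `τ`: the average of
`τ (U ψ)` over all fully separable pure states `ψ`. -/
noncomputable def entanglingPower {n : ℕ} {d : Fin n → ℕ} (τ : (MultiIndex d → ℂ) → ℝ)
    (U : Matrix (MultiIndex d) (MultiIndex d) ℂ) : ℝ :=
  ∫ ψ, τ (U *ᵥ productState d ψ) ∂(separableMeasure d)

/-- The entangling power with respect to the one-tangle. -/
noncomputable def entanglingPowerOne {n : ℕ} {d : Fin n → ℕ}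
    (U : Matrix (MultiIndex d) (MultiIndex d) ℂ) : ℝ :=
  entanglingPower oneTangle U

/-- The average defining the entangling power with respect to the one-tangle is that of an
integrable function. -/
theorem integrable_oneTangle {n : ℕ} {d : Fin n → ℕ} (hd : ∀ i, 1 ≤ d i)
    (U : Matrix (MultiIndex d) (MultiIndex d) ℂ) :
    Integrable (fun ψ => oneTangle (U *ᵥ productState d ψ)) (separableMeasure d) := by
  have := fun i => isProbabilityMeasure_pureStateMeasure (d i) (hd i)
  have : IsProbabilityMeasure (separableMeasure d) := by unfold separableMeasure; infer_instance
  have hp : Continuous (fun ψ : ∀ i, PureState (d i) => productState d ψ) := by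
    unfold productState
    fun_prop
  have hU : Continuous (fun ψ : ∀ i, PureState (d i) => U *ᵥ productState d ψ) :=
    Continuous.matrix_mulVec continuous_const hp
  have hc : Continuous (fun ψ : ∀ i, PureState (d i) => oneTangle (U *ᵥ productState d ψ)) := by
    unfold oneTangle
    exact continuous_const.mul
      (continuous_finsetSum _ fun p _ => (continuous_concurrence p).comp hU)
  exact hc.integrable_of_hasCompactSupport (HasCompactSupport.of_compactSpace _)

/-! ### The constants `B`, `C`, `D` -/

/-- `D = d_1 ⋯ d_n`. -/
noncomputable def constD {n : ℕ} (d : Fin n → ℕ) : ℝ := ∏ i, (d i : ℝ)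

/-- `B = ∑_{i_1, …, i_n ∈ {0, 1}} d_1^{i_1} ⋯ d_n^{i_n}`. -/
noncomputable def constB {n : ℕ} (d : Fin n → ℕ) : ℝ :=
  ∑ e : Fin n → Fin 2, ∏ i, (d i : ℝ) ^ (e i : ℕ)

/-- `C = ∑_{p|q} (d_p + d_q)`, where `d_p` is the product of the `d_i` with `i ∈ p`. -/
noncomputable def constC {n : ℕ} (d : Fin n → ℕ) : ℝ :=
  ∑ p ∈ bipartitions n, ((∏ i ∈ p, (d i : ℝ)) + ∏ i ∈ pᶜ, (d i : ℝ))

end EntanglingPower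

/-! Fix a product state `ψ` and let `x` be its image under a random group element. The purity of a
reduced state of `x` is a sum of fourth moments, two coordinates of `x` times two conjugates, and
invariance of the law of `x` leaves few possibilities for these. Under the orthogonal group they are
a combination of the three pairings of four indices (`exists_fourthMoment_eq_of_orthogonal`), with
weight `α` for the pairing that joins `x` to `x` and conjugate to conjugate, and a common weight `β`
for the other two. Under the unitary group `α = 0` (`exists_fourthMoment_eq_of_unitary`).

Contracting the pairings against the purity tensor gives `D * (α + β * (d_p + d_q))`
(`sum_pairings`), and summing over bipartitions brings in `C`. Two contractions are known
(`contractions_of_fourthMoment_eq`): the squared norm is 1, and in the orthogonal case `s = |∑ x_a ^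
2| ^ 2` is constant on the orbit. They determine `α` and `β`.

By Fubini the group may be averaged first. The unitary orbit mean does not depend on `ψ`. The
orthogonal one is affine in `s`, which factorizes over the parties; the unitary moment formula on
each local sphere gives the factor `2 / (d_i + 1)`, so the mean of `s` is `2 ^ n / B`. -/

namespace EntanglingPower

/-! ### Fourth moments of orthogonally invariant random vectors -/

section FourthMoment

variable {Ω ι : Type*} [MeasurableSpace Ω] [Fintype ι]

/-- The mixed fourth moments of a random complex vector. -/
noncomputable def fourthMoment (μ : Measure Ω) (x : Ω → ι → ℂ) (a b c e : ι) : ℂ :=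
  ∫ ω, x ω a * star (x ω b) * (x ω c * star (x ω e)) ∂μ

/-- The law of the random vector `x` is invariant under the matrix `R`. -/
def LawInvariant (μ : Measure Ω) (x : Ω → ι → ℂ) (R : Matrix ι ι ℂ) : Prop :=
  ∀ f : (ι → ℂ) → ℂ, Continuous f → ∫ ω, f (R *ᵥ x ω) ∂μ = ∫ ω, f (x ω) ∂μ

theorem LawInvariant.fourthMoment_eq {μ : Measure Ω} {x : Ω → ι → ℂ} {R : Matrix ι ι ℂ}
    (h : LawInvariant μ x R) (a b c e : ι) :
    fourthMoment μ (fun ω => R *ᵥ x ω) a b c e = fourthMoment μ x a b c e :=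
  h (fun y => y a * star (y b) * (y c * star (y e))) (by fun_prop)

section

variable {μ : Measure Ω} {x : Ω → ι → ℂ} [TopologicalSpace Ω] [CompactSpace Ω]
  [OpensMeasurableSpace Ω] [IsFiniteMeasure μ]

theorem integrable_of_continuous_of_compactSpace {E : Type*} [NormedAddCommGroup E]
    [SecondCountableTopologyEither Ω E] {f : Ω → E} (hf : Continuous f) : Integrable f μ :=
  hf.integrable_of_hasCompactSupport (HasCompactSupport.of_compactSpace _)

/-- Multilinear expansion. The coefficients stand unconjugated beside the conjugated coordinates,
which suits the real entries of a rotation or reflection. -/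
theorem integral_fourth_power_combination (hx : Continuous x) (s : Fin 2 → ι) (p : Fin 2 → ℂ) :
    ∫ ω, (∑ i, p i * x ω (s i)) * (∑ i, p i * star (x ω (s i))) *
        ((∑ i, p i * x ω (s i)) * (∑ i, p i * star (x ω (s i)))) ∂μ =
      ∑ i, ∑ j, ∑ k, ∑ l, p i * p j * (p k * p l) *
        fourthMoment μ x (s i) (s j) (s k) (s l) := by
  unfold fourthMoment
  simp_rw [← integral_const_mul]
  have hi : ∀ i j k l, Integrable (fun ω => p i * p j * (p k * p l) *
      (x ω (s i) * star (x ω (s j)) * (x ω (s k) * star (x ω (s l))))) μ := fun i j k l =>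
    integrable_of_continuous_of_compactSpace (by fun_prop)
  simp_rw [← integral_finsetSum _ (fun l _ => hi _ _ _ l)]
  simp_rw [← integral_finsetSum _ (fun k _ => integrable_finsetSum _ fun l _ => hi _ _ k l)]
  simp_rw [← integral_finsetSum _ (fun j _ => integrable_finsetSum _ fun k _ =>
    integrable_finsetSum _ fun l _ => hi _ j k l)]
  simp_rw [← integral_finsetSum _ (fun i _ => integrable_finsetSum _ fun j _ =>
    integrable_finsetSum _ fun k _ => integrable_finsetSum _ fun l _ => hi i j k l)]
  congr 1 with ω
  simp only [Fin.sum_univ_two]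
  ring

end

variable [DecidableEq ι]

/-- The reflection along the vector `v`. -/
noncomputable def householder (v : ι → ℝ) : Matrix ι ι ℝ :=
  1 - (2 / (v ⬝ᵥ v)) • Matrix.vecMulVec v v

theorem householder_mem_orthogonalGroup (v : ι → ℝ) (hv : v ⬝ᵥ v ≠ 0) :
    householder v ∈ Matrix.orthogonalGroup ι ℝ := by
  rw [Matrix.mem_orthogonalGroup_iff]
  have hs : (householder v)ᵀ = householder v := by
    simp [householder, Matrix.transpose_sub, Matrix.transpose_smul, Matrix.transpose_vecMulVec]
  have h2 : Matrix.vecMulVec v v * Matrix.vecMulVec v v = (v ⬝ᵥ v) • Matrix.vecMulVec v v := by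
    rw [Matrix.vecMulVec_mul_vecMulVec]
    ext i j
    simp [Matrix.vecMulVec_apply]
    ring
  rw [hs, householder,
    sub_mul, mul_sub, mul_sub, smul_mul_smul_comm, h2]
  ext i j
  simp [smul_smul]
  field_simp
  ring

theorem householder_mulVec_apply (v : ι → ℝ) (y : ι → ℂ) (i : ι) :
    ((householder v).map Complex.ofReal *ᵥ y) i =
      y i - 2 / ((v ⬝ᵥ v : ℝ) : ℂ) * v i * ∑ j, v j * y j := by
  simp only [Matrix.mulVec, dotProduct, householder, Matrix.map_apply, Matrix.sub_apply,
    Matrix.one_apply, Matrix.smul_apply, Matrix.vecMulVec_apply, smul_eq_mul, Complex.ofReal_sub,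
    sub_mul, Finset.sum_sub_distrib, Finset.mul_sum]
  congr 1
  · simp [apply_ite Complex.ofReal]
  · refine Finset.sum_congr rfl fun j _ => ?_
    push_cast
    ring

theorem sum_single_add_single_mul {s t : ι} (p q : ℝ) (y : ι → ℂ) :
    ∑ j, (((Pi.single s p + Pi.single t q : ι → ℝ) j : ℝ) : ℂ) * y j = p * y s + q * y t := by
  simp [Pi.single_apply, apply_ite Complex.ofReal, add_mul, Finset.sum_add_distrib]

theorem householder_single_mulVec (t : ι) (y : ι → ℂ) :
    (householder (Pi.single t 1)).map Complex.ofReal *ᵥ y =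
      fun i => (if i = t then -1 else 1) * y i := by
  ext i
  rw [householder_mulVec_apply]
  by_cases h : i = t
  · subst h
    have := sum_single_add_single_mul (s := i) (t := i) 1 0 y
    simp only [Pi.single_zero, add_zero, Complex.ofReal_one, one_mul, Complex.ofReal_zero,
      zero_mul] at this
    rw [this]
    simp
    ring
  · simp [Pi.single_apply, h]

theorem single_add_single_dotProduct_self {s t : ι} (h : s ≠ t) (p q : ℝ) :
    (Pi.single s p + Pi.single t q : ι → ℝ) ⬝ᵥ (Pi.single s p + Pi.single t q) =
      p ^ 2 + q ^ 2 := by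
  simp [h, h.symm]
  ring

theorem householder_swap_mulVec {s t : ι} (h : s ≠ t) (y : ι → ℂ) :
    (householder (Pi.single s 1 + Pi.single t (-1))).map Complex.ofReal *ᵥ y =
      fun i => y (Equiv.swap s t i) := by
  ext i
  rw [householder_mulVec_apply, sum_single_add_single_mul, single_add_single_dotProduct_self h]
  by_cases hs : i = s
  · subst hs
    simp [h]
    norm_num
  · by_cases ht : i = t
    · subst ht
      simp [h.symm]
      norm_num
    · simp [hs, ht, Equiv.swap_apply_of_ne_of_ne]

/-- Reflecting along `e_s - 2 e_t` mixes two coordinates with the rational weights of the 3-4-5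
triangle, so no square roots occur. -/
theorem householder_rotation_mulVec_left {s t : ι} (h : s ≠ t) (y : ι → ℂ) :
    ((householder (Pi.single s 1 + Pi.single t (-2))).map Complex.ofReal *ᵥ y) s =
      3 / 5 * y s + 4 / 5 * y t := by
  rw [householder_mulVec_apply, sum_single_add_single_mul, single_add_single_dotProduct_self h]
  simp [h]
  norm_num
  ring

variable {μ : Measure Ω} {x : Ω → ι → ℂ}

theorem fourthMoment_sign
    (h : ∀ R ∈ Matrix.orthogonalGroup ι ℝ, LawInvariant μ x (R.map Complex.ofReal))
    (t a b c e : ι) :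
    (if a = t then -1 else 1) * (if b = t then -1 else 1) *
      ((if c = t then -1 else 1) * (if e = t then -1 else 1)) * fourthMoment μ x a b c e =
    fourthMoment μ x a b c e := by
  have hR := h _ (householder_mem_orthogonalGroup (Pi.single t (1 : ℝ)) (by simp))
  refine Eq.trans ?_ (hR.fourthMoment_eq a b c e)
  simp only [householder_single_mulVec]
  unfold fourthMoment
  rw [← integral_const_mul]
  congr 1 with ω
  have hs : ∀ i, star (if i = t then (-1 : ℂ) else 1) = if i = t then -1 else 1 := fun i => by
    split_ifs <;> simp
  simp only [star_mul', hs]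
  ring

/-- Flipping the sign of coordinate `t` multiplies the moment by -1 when `t` occurs an odd number of
times among the four indices. -/
theorem fourthMoment_eq_zero
    (h : ∀ R ∈ Matrix.orthogonalGroup ι ℝ, LawInvariant μ x (R.map Complex.ofReal))
    (t : ι) {a b c e : ι}
    (ht : (if a = t then (-1 : ℂ) else 1) * (if b = t then -1 else 1) *
      ((if c = t then -1 else 1) * (if e = t then -1 else 1)) = -1) :
    fourthMoment μ x a b c e = 0 := by
  have := fourthMoment_sign h t a b c e
  rw [ht] at this
  linear_combination (-1 / 2 : ℂ) * this

/-- A transposition of coordinates is the reflection along `e_s - e_t`, and transpositions generate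
all permutations. -/
theorem fourthMoment_perm
    (h : ∀ R ∈ Matrix.orthogonalGroup ι ℝ, LawInvariant μ x (R.map Complex.ofReal))
    (σ : Equiv.Perm ι) (a b c e : ι) :
    fourthMoment μ x (σ a) (σ b) (σ c) (σ e) = fourthMoment μ x a b c e := by
  induction σ using Equiv.Perm.swap_induction_on generalizing a b c e with
  | one => rfl
  | swap_mul σ s t hst ih =>
    refine Eq.trans ?_ (ih a b c e)
    have hR := h _ (householder_mem_orthogonalGroup
      (Pi.single s (1 : ℝ) + Pi.single t (-1)) (by
        rw [single_add_single_dotProduct_self hst]; norm_num))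
    refine Eq.trans ?_ (hR.fourthMoment_eq (σ a) (σ b) (σ c) (σ e))
    simp only [householder_swap_mulVec hst]
    rfl

variable [TopologicalSpace Ω] [CompactSpace Ω] [OpensMeasurableSpace Ω] [IsFiniteMeasure μ]

/-- Signs and permutations cannot relate a moment with four equal indices to the others; a
reflection mixing two coordinates can. -/
theorem fourthMoment_diag (hx : Continuous x)
    (h : ∀ R ∈ Matrix.orthogonalGroup ι ℝ, LawInvariant μ x (R.map Complex.ofReal))
    {a b : ι} (hab : a ≠ b) :
    fourthMoment μ x a a a a = fourthMoment μ x a b a b + fourthMoment μ x a a b b +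
      fourthMoment μ x a b b a := by
  have hsw := fun c d e f => (fourthMoment_perm h (Equiv.swap a b) c d e f)
  have h1 := hsw a a a a
  have h2 := hsw a b a b
  have h3 := hsw a a b b
  have h4 := hsw a b b a
  simp only [Equiv.swap_apply_left, Equiv.swap_apply_right] at h1 h2 h3 h4
  have hR := (h _ (householder_mem_orthogonalGroup
      (Pi.single a (1 : ℝ) + Pi.single b (-2)) (by
        rw [single_add_single_dotProduct_self hab]; norm_num))).fourthMoment_eq a a a a
  have hexp := integral_fourth_power_combination (μ := μ) hx ![a, b] ![3 / 5, 4 / 5]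
  have hl : fourthMoment μ (fun ω => (householder (Pi.single a 1 + Pi.single b (-2))).map
      Complex.ofReal *ᵥ x ω) a a a a = _ := Eq.trans (by
    unfold fourthMoment
    simp only [householder_rotation_mulVec_left hab]
    congr 1 with ω
    simp [Fin.sum_univ_two]) hexp
  rw [hR] at hl
  simp only [Fin.sum_univ_two, Matrix.cons_val_zero, Matrix.cons_val_one] at hl
  have hba := hab.symm
  rw [h1, h2, h3, h4, fourthMoment_eq_zero h a (a := a) (b := a) (c := a) (e := b) (by simp [hba]),
    fourthMoment_eq_zero h a (a := a) (b := a) (c := b) (e := a) (by simp [hba]),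
    fourthMoment_eq_zero h a (a := a) (b := b) (c := a) (e := a) (by simp [hba]),
    fourthMoment_eq_zero h a (a := b) (b := a) (c := a) (e := a) (by simp [hba]),
    fourthMoment_eq_zero h a (a := a) (b := b) (c := b) (e := b) (by simp [hba]),
    fourthMoment_eq_zero h a (a := b) (b := a) (c := b) (e := b) (by simp [hba]),
    fourthMoment_eq_zero h a (a := b) (b := b) (c := a) (e := b) (by simp [hba]),
    fourthMoment_eq_zero h a (a := b) (b := b) (c := b) (e := a) (by simp [hba])] at hl
  -- The odd moments are gone, and `1 - (3/5)^4 - (4/5)^4 = 288/625 = 2 * (3/5)^2 * (4/5)^2`, so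
  -- both sides carry the same factor.
  linear_combination (625 / 288 : ℂ) * hl

end FourthMoment

/-! ### Invariant pairings and their contractions -/

section Isotropic

variable {Ω ι : Type*} [MeasurableSpace Ω] [Fintype ι] [DecidableEq ι] {μ : Measure Ω}
  {x : Ω → ι → ℂ}

theorem exists_perm_apply_eq {a b c e : ι} (hab : a ≠ b) (hce : c ≠ e) :
    ∃ σ : Equiv.Perm ι, σ a = c ∧ σ b = e := by
  -- The first swap sends `a` to `c`; the second brings the image of `b` to `e` and fixes `c`.
  refine ⟨Equiv.swap (Equiv.swap a c b) e * Equiv.swap a c, ?_, ?_⟩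
  · have h1 : c ≠ Equiv.swap a c b := fun h => hab <| by
      have := congrArg (Equiv.swap a c) h
      simpa using this
    simp [Equiv.swap_apply_of_ne_of_ne h1 hce]
  · simp

theorem map_ofReal_mem_unitaryGroup {O : Matrix ι ι ℝ} (hO : O ∈ Matrix.orthogonalGroup ι ℝ) :
    O.map Complex.ofReal ∈ Matrix.unitaryGroup ι ℂ := by
  rw [Matrix.mem_unitaryGroup_iff]
  rw [Matrix.mem_orthogonalGroup_iff] at hO
  have := congrArg (fun A : Matrix ι ι ℝ => A.map Complex.ofRealHom) hO
  simp only [Matrix.map_mul] at this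
  convert this using 1
  · congr 1
    ext i j
    simp [Matrix.star_apply]
  · ext i j
    simp [Matrix.one_apply]

variable [TopologicalSpace Ω] [CompactSpace Ω] [OpensMeasurableSpace Ω] [IsFiniteMeasure μ]

/-- The fourth moments of a random vector whose law is orthogonally invariant are combinations of
the three invariant pairings, two of which enter symmetrically. -/
theorem exists_fourthMoment_eq_of_orthogonal (hx : Continuous x)
    (h : ∀ R ∈ Matrix.orthogonalGroup ι ℝ, LawInvariant μ x (R.map Complex.ofReal)) :
    ∃ α β : ℂ, ∀ a b c e, fourthMoment μ x a b c e =
      α * ((if a = c then 1 else 0) * (if b = e then 1 else 0)) +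
      β * ((if a = b then 1 else 0) * (if c = e then 1 else 0) +
        (if a = e then 1 else 0) * (if b = c then 1 else 0)) := by
  rcases subsingleton_or_nontrivial ι with hι | hι
  · rcases isEmpty_or_nonempty ι with hι' | ⟨⟨i⟩⟩
    · exact ⟨0, 0, fun a => isEmptyElim a⟩
    -- With a single index all pairings coincide and only `α + 2 * β` is determined.
    · refine ⟨0, fourthMoment μ x i i i i / 2, fun a b c e => ?_⟩
      rw [Subsingleton.elim a i, Subsingleton.elim b i, Subsingleton.elim c i,
        Subsingleton.elim e i]
      simp
      ring
  · obtain ⟨s, t, hst⟩ := exists_pair_ne ι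
    -- Each of these moments meets exactly one pairing, so its value is the weight of that pairing.
    refine ⟨fourthMoment μ x s t s t, fourthMoment μ x s s t t, fun a b c e => ?_⟩
    have hswap : ∀ p q, fourthMoment μ x p q q p = fourthMoment μ x p p q q := fun p q => by
      unfold fourthMoment
      congr 1 with ω
      ring
    have hperm : ∀ {p q}, p ≠ q → fourthMoment μ x p q p q = fourthMoment μ x s t s t ∧
        fourthMoment μ x p p q q = fourthMoment μ x s s t t := fun hpq => by
      obtain ⟨σ, rfl, rfl⟩ := exists_perm_apply_eq hst hpq
      exact ⟨fourthMoment_perm h σ _ _ _ _, fourthMoment_perm h σ _ _ _ _⟩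
    by_cases hab : a = b
    · subst hab
      by_cases hce : c = e
      · subst hce
        by_cases hac : a = c
        · subst hac
          obtain ⟨q, hq⟩ := exists_ne a
          rw [fourthMoment_diag hx h hq.symm, hswap, (hperm hq.symm).1, (hperm hq.symm).2]
          simp
          ring
        · simp [hac, (hperm hac).2]
      · by_cases hac : a = c
        · subst hac
          rw [fourthMoment_eq_zero h e (by simp [hce])]
          simp [hce]
        · rw [fourthMoment_eq_zero h c (by simp [hac, Ne.symm hce])]
          simp [hac, hce]
    · by_cases hac : a = c
      · subst hac
        by_cases hbe : b = e
        · subst hbe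
          simp [hab, (hperm hab).1]
        · rw [fourthMoment_eq_zero h b (by simp [hab, Ne.symm hbe])]
          simp [hab, hbe, Ne.symm hab]
      · by_cases hae : a = e
        · subst hae
          by_cases hbc : b = c
          · subst hbc
            rw [hswap, (hperm hab).2]
            simp [hab]
          · rw [fourthMoment_eq_zero h b (by simp [hab, Ne.symm hbc])]
            simp [hab, hac, hbc]
        · rw [fourthMoment_eq_zero h a (by simp [Ne.symm hab, Ne.symm hac, Ne.symm hae])]
          simp [hab, hac, hae]

/-- The fourth moments of a random vector whose law is unitarily invariant are multiples of
the symmetric projector. -/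
theorem exists_fourthMoment_eq_of_unitary (hx : Continuous x)
    (h : ∀ R ∈ Matrix.unitaryGroup ι ℂ, LawInvariant μ x R) :
    ∃ β : ℂ, ∀ a b c e, fourthMoment μ x a b c e =
      β * ((if a = b then 1 else 0) * (if c = e then 1 else 0) +
        (if a = e then 1 else 0) * (if b = c then 1 else 0)) := by
  have hO : ∀ R ∈ Matrix.orthogonalGroup ι ℝ, LawInvariant μ x (R.map Complex.ofReal) :=
    fun R hR => h _ (map_ofReal_mem_unitaryGroup hR)
  obtain ⟨α, β, hM⟩ := exists_fourthMoment_eq_of_orthogonal hx hO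
  rcases subsingleton_or_nontrivial ι with hι | hι
  · refine ⟨(α + 2 * β) / 2, fun a b c e => ?_⟩
    rw [hM, Subsingleton.elim a b, Subsingleton.elim c b, Subsingleton.elim e b]
    simp
    ring
  · obtain ⟨s, t, hst⟩ := exists_pair_ne ι
    -- This phase multiplies the moment at `s t s t` by `I ^ 2 = -1`, which forces `α = 0`.
    have hD : Matrix.diagonal (fun i => if i = s then Complex.I else 1) ∈
        Matrix.unitaryGroup ι ℂ := by
      rw [Matrix.mem_unitaryGroup_iff, Matrix.star_eq_conjTranspose,
        Matrix.diagonal_conjTranspose, Matrix.diagonal_mul_diagonal, ← Matrix.diagonal_one]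
      congr 1
      ext i
      by_cases hi : i = s <;> simp [hi]
    have h1 := (h _ hD).fourthMoment_eq s t s t
    have h2 : fourthMoment μ (fun ω => Matrix.diagonal (fun i => if i = s then Complex.I else 1)
        *ᵥ x ω) s t s t = -fourthMoment μ x s t s t := by
      unfold fourthMoment
      rw [← integral_neg]
      congr 1 with ω
      simp only [Matrix.mulVec_diagonal, if_true, hst.symm, if_false, one_mul]
      linear_combination (x ω s * star (x ω t) * (x ω s * star (x ω t))) * Complex.I_mul_I
    have hα : α = 0 := by
      rw [h2] at h1
      have h3 := hM s t s t
      simp [hst] at h3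
      rw [h3] at h1
      linear_combination (-1 / 2 : ℂ) * h1
    exact ⟨β, fun a b c e => by rw [hM, hα]; ring⟩

theorem sum_fourthMoment_contract (hx : Continuous x) :
    ∑ a, ∑ c, fourthMoment μ x a c a c =
      ∫ ω, (∑ a, x ω a ^ 2) * star (∑ a, x ω a ^ 2) ∂μ := by
  unfold fourthMoment
  have hi : ∀ a c, Integrable (fun ω => x ω a * star (x ω c) * (x ω a * star (x ω c))) μ :=
    fun a c => integrable_of_continuous_of_compactSpace (by fun_prop)
  simp_rw [← integral_finsetSum _ (fun c _ => hi _ c)]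
  rw [← integral_finsetSum _ (fun a _ => integrable_finsetSum _ fun c _ => hi a c)]
  congr 1 with ω
  rw [star_sum, Finset.sum_mul_sum]
  refine Finset.sum_congr rfl fun a _ => Finset.sum_congr rfl fun c _ => ?_
  rw [star_pow]
  ring

theorem sum_fourthMoment_norm (hx : Continuous x) :
    ∑ a, ∑ c, fourthMoment μ x a a c c = ∫ ω, (∑ a, x ω a * star (x ω a)) ^ 2 ∂μ := by
  unfold fourthMoment
  have hi : ∀ a c, Integrable (fun ω => x ω a * star (x ω a) * (x ω c * star (x ω c))) μ :=
    fun a c => integrable_of_continuous_of_compactSpace (by fun_prop)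
  simp_rw [← integral_finsetSum _ (fun c _ => hi _ c)]
  rw [← integral_finsetSum _ (fun a _ => integrable_finsetSum _ fun c _ => hi a c)]
  congr 1 with ω
  rw [sq, Finset.sum_mul_sum]

theorem contractions_of_fourthMoment_eq (hx : Continuous x) {α β : ℂ}
    (hM : ∀ a b c e, fourthMoment μ x a b c e =
      α * ((if a = c then 1 else 0) * (if b = e then 1 else 0)) +
      β * ((if a = b then 1 else 0) * (if c = e then 1 else 0) +
        (if a = e then 1 else 0) * (if b = c then 1 else 0))) :
    ∫ ω, (∑ a, x ω a ^ 2) * star (∑ a, x ω a ^ 2) ∂μ =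
      α * Fintype.card ι ^ 2 + 2 * β * Fintype.card ι ∧
    ∫ ω, (∑ a, x ω a * star (x ω a)) ^ 2 ∂μ =
      α * Fintype.card ι + β * (Fintype.card ι ^ 2 + Fintype.card ι) := by
  rw [← sum_fourthMoment_contract hx, ← sum_fourthMoment_norm hx]
  simp only [hM]
  constructor
  · simp [Finset.sum_add_distrib, mul_add, eq_comm (a := (_ : ι))]
    ring
  · simp [Finset.sum_add_distrib, mul_add]
    ring

end Isotropic

/-! ### Contraction of the pairings over parties; counting bipartitions -/

section Counting

variable {n : ℕ} {d : Fin n → ℕ}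

theorem sum_sum_prod_eq (f : ∀ i : Fin n, Fin (d i) → Fin (d i) → ℂ) :
    ∑ j : MultiIndex d, ∑ k : MultiIndex d, ∏ i, f i (j i) (k i) =
      ∏ i, ∑ a, ∑ b, f i a b := by
  rw [Finset.prod_univ_sum, Fintype.piFinset_univ]
  refine Finset.sum_congr rfl fun j _ => ?_
  rw [Finset.prod_univ_sum, Fintype.piFinset_univ]

theorem ite_funext_eq_prod (j k : MultiIndex d) :
    (if j = k then (1 : ℂ) else 0) = ∏ i, if j i = k i then 1 else 0 := by
  rw [Finset.prod_ite_zero]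
  simp [funext_iff]

/-- The three invariant pairings, evaluated on the tensor defining the purity of a bipartition. -/
theorem sum_pairings (g : Finset (Fin n)) (α β : ℂ) :
    (∑ j : MultiIndex d, ∑ k : MultiIndex d,
      (α * ((if j = k then 1 else 0) * (if (fun i => if i ∈ g then j i else k i) =
          (fun i => if i ∈ g then k i else j i) then 1 else 0)) +
        β * ((if j = (fun i => if i ∈ g then j i else k i) then 1 else 0) *
            (if k = (fun i => if i ∈ g then k i else j i) then 1 else 0) +
          (if j = (fun i => if i ∈ g then k i else j i) then 1 else 0) *
            (if (fun i => if i ∈ g then j i else k i) = k then 1 else 0)))) =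
      (∏ i, (d i : ℂ)) * (α + β * ((∏ i ∈ g, (d i : ℂ)) + ∏ i ∈ gᶜ, (d i : ℂ))) := by
  simp only [ite_funext_eq_prod, ← Finset.prod_mul_distrib, Finset.sum_add_distrib,
    ← Finset.mul_sum]
  rw [sum_sum_prod_eq (fun i a b => (if a = b then 1 else 0) *
      (if (if i ∈ g then a else b) = (if i ∈ g then b else a) then 1 else 0)),
    sum_sum_prod_eq (fun i a b => (if a = (if i ∈ g then a else b) then 1 else 0) *
      (if b = (if i ∈ g then b else a) then 1 else 0)),
    sum_sum_prod_eq (fun i a b => (if a = (if i ∈ g then b else a) then 1 else 0) *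
      (if (if i ∈ g then a else b) = b then 1 else 0))]
  -- Equality of multi-indices is a product over parties, so each pairing reduces to local sums. The
  -- first always gives `d i`; the other two give `d i ^ 2` on one side of the bipartition and `d i`
  -- on the other.
  have h1 : ∀ i, (∑ a : Fin (d i), ∑ b : Fin (d i), (if a = b then (1 : ℂ) else 0) *
      (if (if i ∈ g then a else b) = (if i ∈ g then b else a) then 1 else 0)) = d i := by
    intro i
    by_cases hi : i ∈ g <;> simp [hi]
  have h2 : ∀ i, (∑ a : Fin (d i), ∑ b : Fin (d i),
      (if a = (if i ∈ g then a else b) then (1 : ℂ) else 0) *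
      (if b = (if i ∈ g then b else a) then 1 else 0)) = d i * if i ∈ g then (d i : ℂ) else 1 := by
    intro i
    by_cases hi : i ∈ g <;> simp [hi]
  have h3 : ∀ i, (∑ a : Fin (d i), ∑ b : Fin (d i),
      (if a = (if i ∈ g then b else a) then (1 : ℂ) else 0) *
      (if (if i ∈ g then a else b) = b then 1 else 0)) =
        d i * if i ∈ gᶜ then (d i : ℂ) else 1 := by
    intro i
    by_cases hi : i ∈ g <;> simp [hi]
  simp only [h1, h2, h3, Finset.prod_mul_distrib, Finset.prod_ite_mem, Finset.univ_inter]
  ring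

theorem bipartitions_eq_Ico (hn : 0 < n) :
    bipartitions n = Finset.Ico {(⟨0, hn⟩ : Fin n)} Finset.univ := by
  ext p
  simp only [bipartitions, Finset.mem_filter, Finset.mem_univ, true_and, Finset.mem_Ico,
    Finset.singleton_subset_iff, Finset.ssubset_univ_iff]
  refine and_congr_left fun _ => ⟨fun h => h _ rfl, fun h i hi => ?_⟩
  rwa [show i = ⟨0, hn⟩ from Fin.ext hi]

theorem card_bipartitions (hn : 0 < n) : ((bipartitions n).card : ℝ) = 2 ^ (n - 1) - 1 := by
  rw [bipartitions_eq_Ico hn, Finset.card_Ico_finset (Finset.subset_univ _)]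
  simp [Nat.one_le_two_pow]

theorem constB_eq (d : Fin n → ℕ) : constB d = ∏ i, ((d i : ℝ) + 1) := by
  have : ∀ i, (d i : ℝ) + 1 = ∑ e : Fin 2, (d i : ℝ) ^ (e : ℕ) := fun i => by
    simp [Fin.sum_univ_two, add_comm]
  simp only [this]
  rw [Finset.prod_univ_sum, Fintype.piFinset_univ]
  rfl

end Counting

/-! ### Moments on the local unit spheres -/

section PureStates

theorem continuous_pureState_coord {d : ℕ} :
    Continuous (fun (ψ : PureState d) (a : Fin d) => (ψ : EuclideanSpace ℂ (Fin d)) a) := by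
  fun_prop

theorem sum_mul_star_pureState {d : ℕ} (ψ : PureState d) :
    ∑ a, (ψ : EuclideanSpace ℂ (Fin d)) a * star ((ψ : EuclideanSpace ℂ (Fin d)) a) = 1 := by
  have h : ‖(ψ : EuclideanSpace ℂ (Fin d))‖ = 1 := by simp
  have h2 := EuclideanSpace.norm_sq_eq (ψ : EuclideanSpace ℂ (Fin d))
  rw [h] at h2
  have h3 := congrArg Complex.ofReal h2
  push_cast at h3
  rw [one_pow] at h3
  rw [h3]
  refine Finset.sum_congr rfl fun a _ => ?_
  exact Complex.mul_conj' _

theorem lawInvariant_pureState {d : ℕ} (R : Matrix (Fin d) (Fin d) ℂ)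
    (hR : R ∈ Matrix.unitaryGroup (Fin d) ℂ) :
    LawInvariant (pureStateMeasure d)
      (fun (ψ : PureState d) (a : Fin d) => (ψ : EuclideanSpace ℂ (Fin d)) a) R := by
  intro f hf
  let u : unitary (EuclideanSpace ℂ (Fin d) →L[ℂ] EuclideanSpace ℂ (Fin d)) :=
    ⟨Matrix.toEuclideanCLM (n := Fin d) (𝕜 := ℂ) R, Unitary.map_mem _ hR⟩
  let V := Unitary.linearIsometryEquiv u
  have hsph : ∀ y : PureState d, V y.1 ∈ Metric.sphere (0 : EuclideanSpace ℂ (Fin d)) 1 := by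
    intro y; have := y.2; simp at this ⊢
  have hc : Continuous (fun y : PureState d => (⟨V y.1, hsph y⟩ : PureState d)) := by fun_prop
  have hfc : Continuous (fun ψ : PureState d =>
      f (fun a => (ψ : EuclideanSpace ℂ (Fin d)) a)) := hf.comp continuous_pureState_coord
  conv_rhs => rw [← pureStateMeasure_invariant d V]
  rw [integral_map hc.measurable.aemeasurable hfc.aestronglyMeasurable]
  rfl

/-- The mean of `|∑ a, ψ_a ^ 2| ^ 2` over the unit sphere of `ℂ^d`. -/
theorem integral_sum_sq_pureState {d : ℕ} (hd : 1 ≤ d) :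
    ∫ ψ : PureState d, (∑ a, (ψ : EuclideanSpace ℂ (Fin d)) a ^ 2) *
      star (∑ a, (ψ : EuclideanSpace ℂ (Fin d)) a ^ 2) ∂(pureStateMeasure d) =
    2 / ((d : ℂ) + 1) := by
  have := isProbabilityMeasure_pureStateMeasure d hd
  obtain ⟨β, hβ⟩ := exists_fourthMoment_eq_of_unitary (μ := pureStateMeasure d)
    continuous_pureState_coord lawInvariant_pureState
  obtain ⟨h1, h2⟩ := contractions_of_fourthMoment_eq (μ := pureStateMeasure d)
    continuous_pureState_coord (α := 0) (β := β) (fun a b c e => by rw [hβ]; ring)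
  simp only [sum_mul_star_pureState] at h2
  rw [h1]
  simp only [one_pow, integral_const, probReal_univ, one_smul, zero_mul, zero_add,
    Fintype.card_fin] at h2 ⊢
  have hd1 : (d : ℂ) + 1 ≠ 0 := Nat.cast_add_one_ne_zero d
  rw [eq_div_iff hd1]
  linear_combination -2 * h2

end PureStates

/-! ### Product states, Fubini, and the mean one-tangle -/

section Products

variable {n : ℕ} {d : Fin n → ℕ}

theorem continuous_productState (d : Fin n → ℕ) :
    Continuous (fun ψ : ∀ i, PureState (d i) => productState d ψ) := by
  unfold productState
  fun_prop

theorem sum_mul_star_productState (ψ : ∀ i, PureState (d i)) :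
    ∑ j, productState d ψ j * star (productState d ψ j) = 1 := by
  simp only [productState, star_prod, ← Finset.prod_mul_distrib]
  rw [← Fintype.piFinset_univ, ← Finset.prod_univ_sum (fun _ => Finset.univ)
    (fun i a => (ψ i : EuclideanSpace ℂ (Fin (d i))) a *
      star ((ψ i : EuclideanSpace ℂ (Fin (d i))) a))]
  simp only [sum_mul_star_pureState, Finset.prod_const_one]

theorem sum_sq_productState (ψ : ∀ i, PureState (d i)) :
    ∑ j, productState d ψ j ^ 2 = ∏ i, ∑ a, (ψ i : EuclideanSpace ℂ (Fin (d i))) a ^ 2 := by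
  simp only [productState, ← Finset.prod_pow]
  rw [← Fintype.piFinset_univ, ← Finset.prod_univ_sum (fun _ => Finset.univ)
    (fun i a => (ψ i : EuclideanSpace ℂ (Fin (d i))) a ^ 2)]

theorem isProbabilityMeasure_separableMeasure (hd : ∀ i, 1 ≤ d i) :
    IsProbabilityMeasure (separableMeasure d) := by
  have := fun i => isProbabilityMeasure_pureStateMeasure (d i) (hd i)
  unfold separableMeasure
  infer_instance

theorem integral_sum_sq_productState (hd : ∀ i, 1 ≤ d i) :
    ∫ ψ, (∑ j, productState d ψ j ^ 2) * star (∑ j, productState d ψ j ^ 2)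
      ∂(separableMeasure d) = ∏ i, 2 / ((d i : ℂ) + 1) := by
  have := fun i => isProbabilityMeasure_pureStateMeasure (d i) (hd i)
  simp only [sum_sq_productState, star_prod, ← Finset.prod_mul_distrib]
  unfold separableMeasure
  rw [integral_fintype_prod_eq_prod (fun i (ψ : PureState (d i)) =>
    (∑ a, (ψ : EuclideanSpace ℂ (Fin (d i))) a ^ 2) *
      star (∑ a, (ψ : EuclideanSpace ℂ (Fin (d i))) a ^ 2))]
  exact Finset.prod_congr rfl fun i _ => integral_sum_sq_pureState (hd i)

theorem continuous_oneTangle : Continuous (fun ψ : MultiIndex d → ℂ => oneTangle ψ) := by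
  unfold oneTangle
  exact continuous_const.mul (continuous_finsetSum _ fun p _ => continuous_concurrence p)

/-- The integrand is continuous on a compact product, so Fubini yields both integrability and the
exchange of the two averages. -/
theorem integral_entanglingPowerOne {G : Type*} [TopologicalSpace G] [CompactSpace G]
    [MeasurableSpace G] [BorelSpace G] {μ : Measure G} [IsFiniteMeasure μ] (hd : ∀ i, 1 ≤ d i)
    {A : G → Matrix (MultiIndex d) (MultiIndex d) ℂ} (hA : Continuous A) :
    Integrable (fun g => entanglingPowerOne (A g)) μ ∧
      ∫ g, entanglingPowerOne (A g) ∂μ =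
        ∫ ψ, ∫ g, oneTangle (A g *ᵥ productState d ψ) ∂μ ∂(separableMeasure d) := by
  have := fun i => isProbabilityMeasure_pureStateMeasure (d i) (hd i)
  have : IsFiniteMeasure (separableMeasure d) := by unfold separableMeasure; infer_instance
  have : SFinite (separableMeasure d) := by unfold separableMeasure; infer_instance
  have hc : Continuous (fun z : G × (∀ i, PureState (d i)) =>
      oneTangle (A z.1 *ᵥ productState d z.2)) :=
    continuous_oneTangle.comp ((hA.comp continuous_fst).matrix_mulVec
      ((continuous_productState d).comp continuous_snd))
  have hi : Integrable (fun z : G × (∀ i, PureState (d i)) =>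
      oneTangle (A z.1 *ᵥ productState d z.2)) (μ.prod (separableMeasure d)) :=
    integrable_of_continuous_of_compactSpace hc
  exact ⟨hi.integral_prod_left, integral_integral_swap hi⟩

/-- The mean one-tangle of a random vector with isotropic fourth moments. -/
theorem integral_oneTangle {Ω : Type*} [TopologicalSpace Ω] [CompactSpace Ω]
    [MeasurableSpace Ω] [OpensMeasurableSpace Ω] {μ : Measure Ω} [IsProbabilityMeasure μ]
    (hn : 2 ≤ n) {x : Ω → MultiIndex d → ℂ} (hx : Continuous x) {α β : ℂ}
    (hM : ∀ a b c e, fourthMoment μ x a b c e =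
      α * ((if a = c then 1 else 0) * (if b = e then 1 else 0)) +
      β * ((if a = b then 1 else 0) * (if c = e then 1 else 0) +
        (if a = e then 1 else 0) * (if b = c then 1 else 0))) :
    ∫ ω, oneTangle (x ω) ∂μ =
      2 * (1 - (constD d * α + constD d * β * (constC d / ((2 : ℝ) ^ (n - 1) - 1) : ℝ)).re) := by
  have htr : ∀ p : Finset (Fin n), Continuous fun ω =>
      Matrix.trace (partialTrace p (ketBra (x ω)) ^ 2) := fun p => by
    simp only [trace_partialTrace_sq]
    fun_prop
  have hpur : ∀ p : Finset (Fin n), ∫ ω, Matrix.trace (partialTrace p (ketBra (x ω)) ^ 2) ∂μ =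
      constD d * α + constD d * β * (((∏ i ∈ p, (d i : ℝ)) + ∏ i ∈ pᶜ, (d i : ℝ) : ℝ) : ℂ) := by
    intro p
    simp only [trace_partialTrace_sq]
    have hi : ∀ j k : MultiIndex d, Integrable (fun ω =>
        x ω j * star (x ω (fun i => if i ∈ p then j i else k i)) *
          (x ω k * star (x ω (fun i => if i ∈ p then k i else j i)))) μ := fun j k =>
      integrable_of_continuous_of_compactSpace (by fun_prop)
    rw [integral_finsetSum _ (fun j _ => integrable_finsetSum _ fun k _ => hi j k)]
    simp_rw [integral_finsetSum _ (fun k _ => hi _ k)]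
    refine Eq.trans (Finset.sum_congr rfl fun j _ => Finset.sum_congr rfl fun k _ =>
      hM j _ k _) ?_
    rw [sum_pairings, constD]
    push_cast
    ring
  have hconc : ∀ p : Finset (Fin n), ∫ ω, concurrence p (x ω) ∂μ =
      2 * (1 - (constD d * α + constD d * β *
        (((∏ i ∈ p, (d i : ℝ)) + ∏ i ∈ pᶜ, (d i : ℝ) : ℝ) : ℂ)).re) := by
    intro p
    have hi : Integrable (fun ω => Matrix.trace (partialTrace p (ketBra (x ω)) ^ 2)) μ :=
      integrable_of_continuous_of_compactSpace (htr p)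
    have hre : ∫ ω, (Matrix.trace (partialTrace p (ketBra (x ω)) ^ 2)).re ∂μ =
        (∫ ω, Matrix.trace (partialTrace p (ketBra (x ω)) ^ 2) ∂μ).re := integral_re hi
    have hir : Integrable (fun ω => (Matrix.trace (partialTrace p (ketBra (x ω)) ^ 2)).re) μ :=
      hi.re
    unfold concurrence
    rw [integral_const_mul, integral_sub (integrable_const _) hir, ← hpur, hre]
    simp
  have hK : ((2 : ℝ) ^ (n - 1) - 1) ≠ 0 := by
    have : (1 : ℝ) < 2 ^ (n - 1) := one_lt_pow₀ one_lt_two (by omega)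
    linarith
  unfold oneTangle
  have hi : ∀ p : Finset (Fin n), Integrable (fun ω => concurrence p (x ω)) μ := fun p =>
    integrable_of_continuous_of_compactSpace ((continuous_concurrence p).comp hx)
  rw [integral_const_mul, integral_finsetSum _ (fun p _ => hi p)]
  simp only [hconc, Complex.add_re, Complex.re_mul_ofReal]
  have hC : ∑ p ∈ bipartitions n, ((∏ i ∈ p, (d i : ℝ)) + ∏ i ∈ pᶜ, (d i : ℝ)) = constC d := rfl
  rw [← Finset.mul_sum, Finset.sum_sub_distrib, Finset.sum_add_distrib, ← Finset.mul_sum, hC]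
  simp only [Finset.sum_const, nsmul_eq_mul, card_bipartitions (show 0 < n by omega)]
  field_simp

end Products

/-! ### Haar-random images of a fixed vector -/

section Haar

variable {ι : Type} [Fintype ι] [DecidableEq ι]

instance instIsProbabilityMeasureHaarProb (G : Type) [Group G] [TopologicalSpace G]
    [IsTopologicalGroup G] [CompactSpace G] [MeasurableSpace G] [BorelSpace G] :
    IsProbabilityMeasure (haarProb G) :=
  ⟨by simpa [haarProb] using Measure.haarMeasure_self (K₀ := (⊤ : TopologicalSpace.PositiveCompacts G))⟩

instance instIsMulLeftInvariantHaarProb (G : Type) [Group G] [TopologicalSpace G]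
    [IsTopologicalGroup G] [CompactSpace G] [MeasurableSpace G] [BorelSpace G] :
    (haarProb G).IsMulLeftInvariant := by
  unfold haarProb
  infer_instance

theorem lawInvariant_unitary (v : ι → ℂ) (R : Matrix ι ι ℂ) (hR : R ∈ Matrix.unitaryGroup ι ℂ) :
    LawInvariant (haarProb (Matrix.unitaryGroup ι ℂ))
      (fun U => (U : Matrix ι ι ℂ) *ᵥ v) R := by
  intro f _
  rw [← integral_mul_left_eq_self (fun U : Matrix.unitaryGroup ι ℂ =>
    f ((U : Matrix ι ι ℂ) *ᵥ v)) ⟨R, hR⟩]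
  simp [Matrix.mulVec_mulVec]

theorem lawInvariant_orthogonal (v : ι → ℂ) (R : Matrix ι ι ℝ)
    (hR : R ∈ Matrix.orthogonalGroup ι ℝ) :
    LawInvariant (haarProb (Matrix.orthogonalGroup ι ℝ))
      (fun O => (O : Matrix ι ι ℝ).map Complex.ofReal *ᵥ v) (R.map Complex.ofReal) := by
  intro f _
  rw [← integral_mul_left_eq_self (fun O : Matrix.orthogonalGroup ι ℝ =>
    f ((O : Matrix ι ι ℝ).map Complex.ofReal *ᵥ v)) ⟨R, hR⟩]
  have : ∀ O : Matrix ι ι ℝ, (R * O).map Complex.ofReal =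
      R.map Complex.ofReal * O.map Complex.ofReal := fun O =>
    Matrix.map_mul (f := Complex.ofRealHom)
  simp [Matrix.mulVec_mulVec, this]

theorem sum_mul_star_mulVec (v : ι → ℂ) {U : Matrix ι ι ℂ} (hU : U ∈ Matrix.unitaryGroup ι ℂ) :
    ∑ a, (U *ᵥ v) a * star ((U *ᵥ v) a) = ∑ a, v a * star (v a) := by
  change (U *ᵥ v) ⬝ᵥ star (U *ᵥ v) = v ⬝ᵥ star v
  rw [Matrix.mem_unitaryGroup_iff'] at hU
  rw [dotProduct_comm, dotProduct_comm v, Matrix.star_mulVec, Matrix.dotProduct_mulVec,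
    Matrix.vecMul_vecMul, ← Matrix.star_eq_conjTranspose, hU, Matrix.vecMul_one]

/-- A real orthogonal matrix preserves the bilinear form as well as the Hermitian one. This second
invariant is what makes the orthogonal orbit mean depend on the product state. -/
theorem sum_sq_mulVec (v : ι → ℂ) {O : Matrix ι ι ℝ} (hO : O ∈ Matrix.orthogonalGroup ι ℝ) :
    ∑ a, (O.map Complex.ofReal *ᵥ v) a ^ 2 = ∑ a, v a ^ 2 := by
  simp only [sq]
  change (O.map Complex.ofReal *ᵥ v) ⬝ᵥ (O.map Complex.ofReal *ᵥ v) = v ⬝ᵥ v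
  have h := map_ofReal_mem_unitaryGroup hO
  rw [Matrix.mem_unitaryGroup_iff'] at h
  have hs : star (O.map Complex.ofReal) = (O.map Complex.ofReal)ᵀ := by
    ext i j
    simp [Matrix.star_apply]
  rw [hs] at h
  rw [Matrix.dotProduct_mulVec, ← Matrix.mulVec_transpose, Matrix.mulVec_mulVec, h,
    Matrix.one_mulVec]

end Haar

/-! ### Orbit means for the two groups -/

section Means

variable {n : ℕ} {d : Fin n → ℕ}

theorem card_multiIndex (d : Fin n → ℕ) : (Fintype.card (MultiIndex d) : ℂ) = constD d := by
  simp [constD, Fintype.card_pi]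

theorem constD_pos (hd : ∀ i, 1 ≤ d i) : 0 < constD d :=
  Finset.prod_pos fun i _ => by exact_mod_cast hd i

theorem constB_pos (d : Fin n → ℕ) : 0 < constB d := by
  rw [constB_eq]
  exact Finset.prod_pos fun i _ => by positivity

theorem prod_one_div_add_one (d : Fin n → ℕ) : ∏ i, 1 / ((d i : ℝ) + 1) = 1 / constB d := by
  rw [constB_eq, Finset.prod_div_distrib, Finset.prod_const_one]

theorem integral_two_mul_one_sub_affine {Ω : Type*} [MeasurableSpace Ω] {μ : Measure Ω}
    [IsProbabilityMeasure μ] {f : Ω → ℝ} (hf : Integrable f μ) (a b c : ℝ) :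
    ∫ ω, 2 * (1 - (a + b * f ω) / c) ∂μ = 2 * (1 - (a + b * ∫ ω, f ω ∂μ) / c) := by
  have h1 : Integrable (fun ω => b * f ω) μ := hf.const_mul b
  have h2 : Integrable (fun ω => (a + b * f ω) / c) μ :=
    ((integrable_const a).add h1).div_const c
  rw [integral_const_mul, integral_sub (integrable_const _) h2, integral_div,
    integral_add (integrable_const _) h1, integral_const_mul]
  simp

/-- The mean one-tangle over the orbit of a product state under the unitary group. -/
theorem integral_oneTangle_unitary (hn : 2 ≤ n) (hd : ∀ i, 1 ≤ d i)
    (ψ : ∀ i, PureState (d i)) :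
    ∫ U : Matrix.unitaryGroup (MultiIndex d) ℂ,
      oneTangle ((U : Matrix (MultiIndex d) (MultiIndex d) ℂ) *ᵥ productState d ψ)
      ∂(haarProb (Matrix.unitaryGroup (MultiIndex d) ℂ)) =
    2 * (1 - 1 / (constD d + 1) * (constC d / ((2 : ℝ) ^ (n - 1) - 1))) := by
  have hx : Continuous fun U : Matrix.unitaryGroup (MultiIndex d) ℂ =>
      (U : Matrix (MultiIndex d) (MultiIndex d) ℂ) *ᵥ productState d ψ :=
    continuous_subtype_val.matrix_mulVec continuous_const
  obtain ⟨β, hβ⟩ := exists_fourthMoment_eq_of_unitary hx (lawInvariant_unitary (productState d ψ))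
  have hM : ∀ a b c e, fourthMoment (haarProb (Matrix.unitaryGroup (MultiIndex d) ℂ))
      (fun U => (U : Matrix (MultiIndex d) (MultiIndex d) ℂ) *ᵥ productState d ψ) a b c e =
      0 * ((if a = c then 1 else 0) * (if b = e then 1 else 0)) +
      β * ((if a = b then 1 else 0) * (if c = e then 1 else 0) +
        (if a = e then 1 else 0) * (if b = c then 1 else 0)) := fun a b c e => by
    rw [hβ a b c e, zero_mul, zero_add]
  rw [integral_oneTangle hn hx hM]
  have hN := (contractions_of_fourthMoment_eq hx hM).2
  simp only [fun U : Matrix.unitaryGroup (MultiIndex d) ℂ =>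
    sum_mul_star_mulVec (productState d ψ) U.2, sum_mul_star_productState, one_pow,
    integral_const, probReal_univ, one_smul, card_multiIndex] at hN
  have hD : (constD d : ℂ) + 1 ≠ 0 := by
    have := constD_pos hd
    exact_mod_cast (by linarith : (constD d + 1 : ℝ) ≠ 0)
  have hβ' : (constD d : ℂ) * β = (1 / (constD d + 1) : ℝ) := by
    push_cast
    rw [eq_div_iff hD]
    linear_combination -hN
  rw [hβ', mul_zero, zero_add, ← Complex.ofReal_mul, Complex.ofReal_re]

/-- The mean one-tangle over the orbit of a product state under the orthogonal group. -/
theorem integral_oneTangle_orthogonal (hn : 2 ≤ n) (hD : 1 < constD d)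
    (ψ : ∀ i, PureState (d i)) :
    ∫ O : Matrix.orthogonalGroup (MultiIndex d) ℝ,
      oneTangle ((O : Matrix (MultiIndex d) (MultiIndex d) ℝ).map Complex.ofReal *ᵥ
        productState d ψ) ∂(haarProb (Matrix.orthogonalGroup (MultiIndex d) ℝ)) =
    2 * (1 - ((constD d * (constC d / ((2 : ℝ) ^ (n - 1) - 1)) - 2) +
      (constD d + 1 - constC d / ((2 : ℝ) ^ (n - 1) - 1)) *
        ((∑ j, productState d ψ j ^ 2) * star (∑ j, productState d ψ j ^ 2)).re) /
        ((constD d - 1) * (constD d + 2))) := by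
  have hx : Continuous fun O : Matrix.orthogonalGroup (MultiIndex d) ℝ =>
      (O : Matrix (MultiIndex d) (MultiIndex d) ℝ).map Complex.ofReal *ᵥ productState d ψ :=
    (continuous_subtype_val.matrix_map Complex.continuous_ofReal).matrix_mulVec continuous_const
  obtain ⟨α, β, hM⟩ := exists_fourthMoment_eq_of_orthogonal hx
    (lawInvariant_orthogonal (productState d ψ))
  rw [integral_oneTangle hn hx hM]
  obtain ⟨hS, hN⟩ := contractions_of_fourthMoment_eq hx hM
  simp only [fun O : Matrix.orthogonalGroup (MultiIndex d) ℝ =>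
    sum_mul_star_mulVec (productState d ψ) (map_ofReal_mem_unitaryGroup O.2),
    sum_mul_star_productState, one_pow, integral_const, probReal_univ, one_smul,
    card_multiIndex] at hN
  simp only [fun O : Matrix.orthogonalGroup (MultiIndex d) ℝ =>
    sum_sq_mulVec (productState d ψ) O.2, integral_const, probReal_univ, one_smul,
    card_multiIndex] at hS
  have hreal : (∑ j, productState d ψ j ^ 2) * star (∑ j, productState d ψ j ^ 2) =
      (((∑ j, productState d ψ j ^ 2) * star (∑ j, productState d ψ j ^ 2)).re : ℂ) := by
    rw [Complex.star_def, Complex.mul_conj, Complex.ofReal_re]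
  generalize ((∑ j, productState d ψ j ^ 2) * star (∑ j, productState d ψ j ^ 2)).re = s at *
  rw [hreal] at hS
  have h0 : constD d ≠ 0 := by linarith
  have h1 : constD d - 1 ≠ 0 := by linarith
  have h2 : constD d + 2 ≠ 0 := by linarith
  have h3 : constD d + 1 ≠ 0 := by linarith
  have h3' : (constD d : ℂ) + 1 ≠ 0 := by exact_mod_cast h3
  -- In the unknowns `D * α` and `D * β`, the system `hS`, `hN` has determinant `D * (D + 1) - 2 =
  -- (D - 1) * (D + 2)`; the next two steps are Cramer's rule.
  have h12 : ((constD d : ℂ) - 1) * (constD d + 2) ≠ 0 := by exact_mod_cast mul_ne_zero h1 h2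
  have hα : (constD d : ℂ) * α =
      (((constD d + 1) * s - 2) / ((constD d - 1) * (constD d + 2)) : ℝ) := by
    push_cast
    rw [eq_div_iff h12]
    linear_combination (-(constD d + 1) : ℂ) * hS + 2 * hN
  have hβ : (constD d : ℂ) * β =
      ((constD d - s) / ((constD d - 1) * (constD d + 2)) : ℝ) := by
    push_cast
    rw [eq_div_iff h12]
    linear_combination hS - (constD d : ℂ) * hN
  rw [hα, hβ, ← Complex.ofReal_mul, ← Complex.ofReal_add, Complex.ofReal_re]
  field_simp
  ring

end Means

end EntanglingPower

/-! ### Averaging the orbit means over product states -/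

theorem mainTheorem8 (n : ℕ) (hn : 2 ≤ n) (d : Fin n → ℕ) (hd : ∀ i, 1 ≤ d i) :
    (Integrable
        (fun U : Matrix.unitaryGroup (EntanglingPower.MultiIndex d) ℂ =>
          EntanglingPower.entanglingPowerOne
            (U : Matrix (EntanglingPower.MultiIndex d) (EntanglingPower.MultiIndex d) ℂ))
        (EntanglingPower.haarProb (Matrix.unitaryGroup (EntanglingPower.MultiIndex d) ℂ)) ∧
      ∫ U : Matrix.unitaryGroup (EntanglingPower.MultiIndex d) ℂ,
          EntanglingPower.entanglingPowerOne
            (U : Matrix (EntanglingPower.MultiIndex d) (EntanglingPower.MultiIndex d) ℂ)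
          ∂(EntanglingPower.haarProb (Matrix.unitaryGroup (EntanglingPower.MultiIndex d) ℂ)) =
        2 * (1 - (∏ i, 1 / ((d i : ℝ) + 1)) *
          (EntanglingPower.constB d * EntanglingPower.constC d /
            (((2 : ℝ) ^ (n - 1) - 1) * (EntanglingPower.constD d + 1))))) ∧
    (1 < EntanglingPower.constD d →
      Integrable
        (fun O : Matrix.orthogonalGroup (EntanglingPower.MultiIndex d) ℝ =>
          EntanglingPower.entanglingPowerOne
            ((O : Matrix (EntanglingPower.MultiIndex d) (EntanglingPower.MultiIndex d) ℝ).map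
              Complex.ofReal))
        (EntanglingPower.haarProb (Matrix.orthogonalGroup (EntanglingPower.MultiIndex d) ℝ)) ∧
      ∫ O : Matrix.orthogonalGroup (EntanglingPower.MultiIndex d) ℝ,
          EntanglingPower.entanglingPowerOne
            ((O : Matrix (EntanglingPower.MultiIndex d) (EntanglingPower.MultiIndex d) ℝ).map
              Complex.ofReal)
          ∂(EntanglingPower.haarProb (Matrix.orthogonalGroup (EntanglingPower.MultiIndex d) ℝ)) =
        2 * (1 - (∏ i, 1 / ((d i : ℝ) + 1)) *
          (((2 : ℝ) ^ n * (EntanglingPower.constD d + 1) - 2 * EntanglingPower.constB d +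
              (EntanglingPower.constB d * EntanglingPower.constD d - (2 : ℝ) ^ n) /
                ((2 : ℝ) ^ (n - 1) - 1) * EntanglingPower.constC d) /
            ((EntanglingPower.constD d - 1) * (EntanglingPower.constD d + 2))))) := by
  open EntanglingPower in
  have hsep : IsProbabilityMeasure (separableMeasure d) :=
    isProbabilityMeasure_separableMeasure hd
  have hB := (constB_pos d).ne'
  have hK : ((2 : ℝ) ^ (n - 1) - 1) ≠ 0 := by
    have : (1 : ℝ) < 2 ^ (n - 1) := one_lt_pow₀ one_lt_two (by omega)
    linarith
  rw [prod_one_div_add_one]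
  refine ⟨?_, fun hD => ?_⟩
  · obtain ⟨hi, he⟩ := integral_entanglingPowerOne hd
      (A := fun U : Matrix.unitaryGroup (MultiIndex d) ℂ => (U : Matrix _ _ ℂ))
      (μ := haarProb (Matrix.unitaryGroup (MultiIndex d) ℂ)) continuous_subtype_val
    refine ⟨hi, he.trans ?_⟩
    have hD1 : constD d + 1 ≠ 0 := by linarith [constD_pos hd]
    simp only [integral_oneTangle_unitary hn hd, integral_const, probReal_univ, one_smul]
    field_simp
  · obtain ⟨hi, he⟩ := integral_entanglingPowerOne hd
      (A := fun O : Matrix.orthogonalGroup (MultiIndex d) ℝ =>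
        (O : Matrix _ _ ℝ).map Complex.ofReal)
      (μ := haarProb (Matrix.orthogonalGroup (MultiIndex d) ℝ))
      (continuous_subtype_val.matrix_map Complex.continuous_ofReal)
    refine ⟨hi, he.trans ?_⟩
    simp only [integral_oneTangle_orthogonal hn hD]
    have his : Integrable (fun ψ => (∑ j, productState d ψ j ^ 2) *
        star (∑ j, productState d ψ j ^ 2)) (separableMeasure d) := by
      have hc := continuous_productState d
      exact integrable_of_continuous_of_compactSpace (by fun_prop)
    have hs : ∫ ψ, ((∑ j, productState d ψ j ^ 2) * star (∑ j, productState d ψ j ^ 2)).re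
        ∂(separableMeasure d) = 2 ^ n / constB d := by
      refine (integral_re his).trans ?_
      rw [integral_sum_sq_productState hd, constB_eq]
      have : (∏ i, 2 / ((d i : ℂ) + 1)) = ((∏ i, 2 / ((d i : ℝ) + 1) : ℝ) : ℂ) := by push_cast; rfl
      rw [this, Finset.prod_div_distrib, Finset.prod_const, Finset.card_univ, Fintype.card_fin]
      exact Complex.ofReal_re _
    have his' : Integrable (fun ψ => ((∑ j, productState d ψ j ^ 2) *
        star (∑ j, productState d ψ j ^ 2)).re) (separableMeasure d) := his.re
    -- The orbit mean is affine in `s`, so only the mean of `s` over product states enters.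
    rw [integral_two_mul_one_sub_affine his', hs]
    have h1 : constD d - 1 ≠ 0 := by linarith
    have h2 : constD d + 2 ≠ 0 := by linarith
    field_simp
    ring
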